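/- There is an absolute constant $C>0$ such that the following holds for all integers $d\ge 1$, $1\le s\le d$ and $k\ge 0$. Let $\mu$ be the Haar measure on the pure states of $\mathbb{C}^d$, that is, the unitarily invariant probability measure on the unit sphere of $\mathbb{C}^d$, and write $\psi=|\psi\rangle\langle\psi|$ for a unit vector $|\psi\rangle$. For $S\subseteq[d]=\{1,\dots,d\}$ with $|S|=s$ let \[ \phi_S=\Big(\frac{1}{\sqrt s}\sum_{i\in S}|i\rangle\Big)\Big(\frac{1}{\sqrt s}\sum_{i\in S}\langle i|\Big) \] be the projector onto the uniform superposition over $S$, where $|1\rangle,\dots,|d\rangle$ is the standard basis of $\mathbb{C}^d$. Then \[ \left\| \int \psi^{\otimes k}\,d\mu(\psi) - \mathop{\mathbb{E}}_{S\subseteq[d],\,|S|=s}\phi_S^{\otimes k}\right\|_1 \le C\left(\frac{k^2}{d}+\frac{k}{\sqrt s}+\frac{sk}{d}\right), \] where the expectation is over a uniformly random subset $S\subseteq [d]$ of size $s$ and $\|M\|_1$ is the trace norm, the sum of the singular values of $M$. -/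

import Mathlib

open MeasureTheory
open scoped Matrix ENNReal

/-- The trace norm of a complex square matrix: the sum of its singular values. -/
noncomputable def traceNorm {n : Type*} [Fintype n] [DecidableEq n] (M : Matrix n n ℂ) : ℝ :=
  (Matrix.toEuclideanLin M).singularValues.sum fun _ σ => σ

/-- The operator `|v⟩⟨v|` on `ℂ^d`, as a matrix in the computational basis. -/
def ketBra {d : ℕ} (v : EuclideanSpace ℂ (Fin d)) : Matrix (Fin d) (Fin d) ℂ :=
  Matrix.of fun a b => v a * star (v b)

/-- The `k`-fold tensor power `M ⊗ ⋯ ⊗ M` of an operator on `ℂ^d`, as an operator on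
`(ℂ^d)^{⊗k}`; its rows and columns are indexed by the computational basis `[d]^k`. -/
def tensorPower {d : ℕ} (M : Matrix (Fin d) (Fin d) ℂ) (k : ℕ) :
    Matrix (Fin k → Fin d) (Fin k → Fin d) ℂ :=
  Matrix.of fun i j => ∏ a, M (i a) (j a)

/-- The Haar (uniform) probability measure on the pure states of `ℂ^d`: the normalized surface
measure of the unit sphere of `ℂ^d`. -/
noncomputable def haarState (d : ℕ) :
    Measure (Metric.sphere (0 : EuclideanSpace ℂ (Fin d)) 1) :=
  ((volume : Measure (EuclideanSpace ℂ (Fin d))).toSphere Set.univ)⁻¹ •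
    (volume : Measure (EuclideanSpace ℂ (Fin d))).toSphere

theorem haarState_isProbabilityMeasure (d : ℕ) (hd : 1 ≤ d) :
    IsProbabilityMeasure (haarState d) := by
  have : Nonempty (Fin d) := ⟨⟨0, hd⟩⟩
  have : Nontrivial (EuclideanSpace ℂ (Fin d)) := inferInstance
  constructor
  rw [haarState, Measure.smul_apply, smul_eq_mul]
  refine ENNReal.inv_mul_cancel ?_ (measure_ne_top _ _)
  rw [Ne, Measure.measure_univ_eq_zero]
  exact Measure.toSphere_ne_zero _

/-- The action of a unitary operator on the unit sphere of `ℂ^d`. -/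
noncomputable def unitaryOnSphere {d : ℕ} (U : EuclideanSpace ℂ (Fin d) ≃ₗᵢ[ℂ] EuclideanSpace ℂ (Fin d))
    (ψ : Metric.sphere (0 : EuclideanSpace ℂ (Fin d)) 1) :
    Metric.sphere (0 : EuclideanSpace ℂ (Fin d)) 1 :=
  ⟨U ψ, by simp⟩

open scoped Pointwise in
/-- The measure `haarState d` is invariant under all unitary operators. -/
theorem haarState_map_unitary {d : ℕ}
    (U : EuclideanSpace ℂ (Fin d) ≃ₗᵢ[ℂ] EuclideanSpace ℂ (Fin d)) :
    (haarState d).map (unitaryOnSphere U) = haarState d := by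
  have hm : Measurable (unitaryOnSphere U) :=
    (U.continuous.measurable.comp measurable_subtype_coe).subtype_mk
  rw [haarState, Measure.map_smul]
  congr 1
  ext A hA
  rw [Measure.map_apply hm hA, Measure.toSphere_apply' _ (hm hA), Measure.toSphere_apply' _ hA]
  congr 1
  let V : EuclideanSpace ℂ (Fin d) ≃ₗᵢ[ℝ] EuclideanSpace ℂ (Fin d) :=
    { U.toLinearEquiv.restrictScalars ℝ with norm_map' := U.norm_map }
  have hV : MeasurePreserving V := V.measurePreserving
  rw [← hV.measure_preimage_emb V.toMeasurableEquiv.measurableEmbedding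
    (Set.Ioo (0 : ℝ) 1 • (Subtype.val '' A))]
  congr 1
  ext x
  simp only [Set.mem_smul, Set.mem_image, Set.mem_preimage]
  constructor
  · rintro ⟨r, hr, _, ⟨ψ, hψ, rfl⟩, rfl⟩
    exact ⟨r, hr, _, ⟨_, hψ, rfl⟩, (V.map_smul r _).symm⟩
  · rintro ⟨r, hr, _, ⟨ψ, hψ, rfl⟩, h⟩
    refine ⟨r, hr, V.symm ψ, ⟨⟨V.symm ψ, by simp⟩, ?_, rfl⟩, ?_⟩
    · have : unitaryOnSphere U ⟨V.symm ψ, by simp⟩ = ψ := Subtype.ext (V.apply_symm_apply _)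
      simpa [this] using hψ
    · apply V.injective
      rw [← h, V.map_smul, V.apply_symm_apply]

/-- The `k`-copy Haar moment `∫ ψ^{⊗k} dμ(ψ)`, the integral being taken entrywise. -/
noncomputable def haarMoment (d k : ℕ) : Matrix (Fin k → Fin d) (Fin k → Fin d) ℂ :=
  Matrix.of fun i j => ∫ ψ, tensorPower (ketBra ψ.1) k i j ∂(haarState d)

/-- The integrands in `haarMoment` are integrable. -/
theorem haarMoment_integrable (d k : ℕ) (i j : Fin k → Fin d) :
    Integrable (fun ψ => tensorPower (ketBra ψ.1) k i j) (haarState d) := by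
  have hc : Continuous fun ψ : Metric.sphere (0 : EuclideanSpace ℂ (Fin d)) 1 =>
      tensorPower (ketBra ψ.1) k i j := by
    simp only [tensorPower, ketBra, Matrix.of_apply]
    fun_prop
  rcases Nat.eq_zero_or_pos d with rfl | hd
  · have : IsEmpty (Metric.sphere (0 : EuclideanSpace ℂ (Fin 0)) 1) := by
      refine ⟨fun ψ => ?_⟩
      have h := ψ.2
      rw [Subsingleton.elim ψ.1 0] at h
      simp at h
    rw [Measure.eq_zero_of_isEmpty (haarState 0)]
    exact integrable_zero_measure
  · have := haarState_isProbabilityMeasure d hd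
    have : CompactSpace (Metric.sphere (0 : EuclideanSpace ℂ (Fin d)) 1) :=
      isCompact_iff_compactSpace.mp (isCompact_sphere _ _)
    exact hc.integrable_of_hasCompactSupport (HasCompactSupport.of_compactSpace _)

/-- The subset state `|S|^{-1/2} ∑_{i ∈ S} |i⟩`. -/
noncomputable def subsetState {d : ℕ} (S : Finset (Fin d)) : EuclideanSpace ℂ (Fin d) :=
  ((1 / Real.sqrt S.card : ℝ) : ℂ) • ∑ i ∈ S, EuclideanSpace.single i 1

/-- The average `𝔼_S φ_S^{⊗k}` over the uniformly random `S ⊆ [d]` of size `s`, where `φ_S` is the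
projector onto the subset state of `S`. -/
noncomputable def subsetMoment (d s k : ℕ) : Matrix (Fin k → Fin d) (Fin k → Fin d) ℂ :=
  ((Finset.powersetCard s (Finset.univ : Finset (Fin d))).card : ℂ)⁻¹ •
    ∑ S ∈ Finset.powersetCard s (Finset.univ : Finset (Fin d)), tensorPower (ketBra (subsetState S)) k

/-! Both moments are compared with a multiple of one matrix, `distinctSym d k`, which is block
diagonal over the `k`-element subsets of `[d]`. In each comparison the main error is positive
semidefinite, so its trace norm is its trace, and only scalar traces need estimating.

Haar side: invariance under sign flips and permutations of coordinates forces every entry with an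
injective row or column index to agree with `h • distinctSym d k`. What remains is the moment of the
part of `ψ^{⊗k}` on tuples with a repetition. Its trace is a collision probability, at most `k² ∑ₓ
𝔼|ψₓ|⁴ ≤ 2k²/d` (`exists_posSplit_haarMoment_sub`).

Subset side: discarding repeated tuples from each `φ_S^{⊗k}` costs `2k/√s + k²/s`
(`posSplit_tensorPower_sub`). An entry of the truncated average then depends only on the size of the
intersection of the two index sets. Vandermonde's identity writes it as a nonnegative combination of
the Gram matrices `inclusionGram d k r`; the term `r = k` is `distinctSym d k`, so the other terms
form a positive semidefinite remainder (`subsetMomentDistinct_sub_posSemidef`). The main term has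
trace at least `1 - k²/s - 2sk/d` (`one_sub_le_subsetWeight_mul`), which bounds the remainder
because the total trace is at most `1`.

Errors are tracked through `PosSplit`, whose bounds add formally; `traceNorm_sub_le` turns the final
one into a trace norm bound. -/

open scoped ComplexOrder

/-! ### Trace norm bounds from positive semidefinite splittings -/

section TraceNorm

variable {n : Type*} [Fintype n]

/-- The eigenvalues of `T* T = T²` are the squares of those of `T`. The two lists may be ordered
differently, so they are compared as multisets of roots of a characteristic polynomial. -/
theorem LinearMap.IsSymmetric.sum_singularValues {E : Type*} [NormedAddCommGroup E]
    [InnerProductSpace ℂ E] [FiniteDimensional ℂ E] {T : E →ₗ[ℂ] E} (hT : T.IsSymmetric) :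
    (T.singularValues.sum fun _ σ => σ) = ∑ i, |hT.eigenvalues rfl i| := by
  have hsum : (T.singularValues.sum fun _ σ => σ) =
      ∑ i : Fin (Module.finrank ℂ E), T.singularValues i := by
    rw [Finsupp.sum_of_support_subset (s := Finset.range (Module.finrank ℂ E)),
      Fin.sum_univ_eq_sum_range (fun i => T.singularValues i)]
    · intro i hi
      by_contra h
      rw [Finset.mem_range, not_lt] at h
      exact (Finsupp.mem_support_iff.mp hi) (T.singularValues_of_finrank_le h)
    · simp
  have hadj : T.adjoint = T := (LinearMap.isSymmetric_iff_isSelfAdjoint T).mp hT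
  have hchar : (T.adjoint ∘ₗ T).charpoly =
      ∏ i, (Polynomial.X - Polynomial.C (((hT.eigenvalues rfl i) ^ 2 : ℝ) : ℂ)) := by
    let b := (hT.eigenvectorBasis rfl).toBasis
    rw [hadj, ← LinearMap.charpoly_toMatrix _ b, LinearMap.toMatrix_comp b b b]
    rw [hT.toMatrix_eigenvectorBasis, Matrix.diagonal_mul_diagonal, Matrix.charpoly_diagonal]
    simp [pow_two]
  have hroots : (T.adjoint ∘ₗ T).charpoly.roots =
      Multiset.map (fun i => (((hT.eigenvalues rfl i) ^ 2 : ℝ) : ℂ)) Finset.univ.val := by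
    rw [hchar, Polynomial.roots_prod]
    · simp only [Polynomial.roots_X_sub_C, Multiset.bind_singleton]
    · exact Finset.prod_ne_zero_iff.mpr fun i _ => Polynomial.X_sub_C_ne_zero _
  have h2 := T.isSymmetric_adjoint_comp_self.roots_charpoly_eq_eigenvalues rfl
  rw [hroots] at h2
  have h3 := congrArg (fun m => (m.map fun z : ℂ => √z.re).sum) h2
  simp only [Multiset.map_map, Function.comp_def, Complex.ofReal_re, Real.sqrt_sq_eq_abs] at h3
  rw [hsum]
  simp only [T.singularValues_fin rfl]
  exact h3.symm

theorem re_trace_eq_sum_inner [DecidableEq n] {m : ℕ} (M : Matrix n n ℂ)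
    (b : OrthonormalBasis (Fin m) ℂ (EuclideanSpace ℂ n)) :
    M.trace.re = ∑ i, (inner ℂ (b i) (Matrix.toEuclideanLin M (b i))).re := by
  rw [← Complex.re_sum, ← LinearMap.trace_eq_sum_inner]
  congr 1
  rw [Matrix.toEuclideanLin_eq_toLin_orthonormal, LinearMap.trace_eq_matrix_trace ℂ
    (EuclideanSpace.basisFun n ℂ).toBasis, LinearMap.toMatrix_toLin]

theorem Matrix.PosSemidef.re_inner_nonneg [DecidableEq n] {M : Matrix n n ℂ} (hM : M.PosSemidef)
    (v : EuclideanSpace ℂ n) : 0 ≤ (inner ℂ v (Matrix.toEuclideanLin M v)).re := by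
  have := hM.re_dotProduct_nonneg v.ofLp
  rw [EuclideanSpace.inner_eq_star_dotProduct, dotProduct_comm]
  simpa [Matrix.toLpLin_apply] using this

/-- In an orthonormal eigenbasis of `X - Y`, each eigenvalue is a difference of the nonnegative
diagonal entries of `X` and `Y`, hence at most their sum in absolute value. -/
theorem traceNorm_sub_le [DecidableEq n] {X Y : Matrix n n ℂ} (hX : X.PosSemidef) (hY : Y.PosSemidef) :
    traceNorm (X - Y) ≤ X.trace.re + Y.trace.re := by
  have hT : (Matrix.toEuclideanLin (X - Y)).IsSymmetric :=
    Matrix.isSymmetric_toEuclideanLin_iff.mpr (hX.isHermitian.sub hY.isHermitian)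
  let b := hT.eigenvectorBasis rfl
  rw [traceNorm, hT.sum_singularValues, re_trace_eq_sum_inner X b, re_trace_eq_sum_inner Y b,
    ← Finset.sum_add_distrib]
  refine Finset.sum_le_sum fun i _ => ?_
  have h : hT.eigenvalues rfl i = (inner ℂ (b i) (Matrix.toEuclideanLin X (b i))).re -
      (inner ℂ (b i) (Matrix.toEuclideanLin Y (b i))).re := by
    have := hT.apply_eigenvectorBasis rfl i
    rw [← Complex.sub_re, ← inner_sub_right, ← LinearMap.sub_apply, ← map_sub, this,
      inner_smul_right, inner_self_eq_norm_sq_to_K]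
    simp
  have hx := hX.re_inner_nonneg (b i)
  have hy := hY.re_inner_nonneg (b i)
  rw [h, abs_le]
  constructor <;> linarith

/-- `M` is a difference of two positive semidefinite matrices of total trace at most `r`. -/
def PosSplit (M : Matrix n n ℂ) (r : ℝ) : Prop :=
  ∃ X Y : Matrix n n ℂ, X.PosSemidef ∧ Y.PosSemidef ∧ M = X - Y ∧ X.trace.re + Y.trace.re ≤ r

namespace PosSplit

variable {M N : Matrix n n ℂ} {r t : ℝ}

theorem traceNorm_le [DecidableEq n] (h : PosSplit M r) : traceNorm M ≤ r := by
  obtain ⟨X, Y, hX, hY, rfl, hr⟩ := h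
  exact (traceNorm_sub_le hX hY).trans hr

theorem mono (h : PosSplit M r) (hrt : r ≤ t) : PosSplit M t := by
  obtain ⟨X, Y, hX, hY, rfl, hr⟩ := h
  exact ⟨X, Y, hX, hY, rfl, hr.trans hrt⟩

theorem neg (h : PosSplit M r) : PosSplit (-M) r := by
  obtain ⟨X, Y, hX, hY, rfl, hr⟩ := h
  exact ⟨Y, X, hY, hX, by abel, by linarith⟩

theorem add (h : PosSplit M r) (h' : PosSplit N t) : PosSplit (M + N) (r + t) := by
  obtain ⟨X, Y, hX, hY, rfl, hr⟩ := h
  obtain ⟨X', Y', hX', hY', rfl, hr'⟩ := h'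
  refine ⟨X + X', Y + Y', hX.add hX', hY.add hY', by abel, ?_⟩
  simp only [Matrix.trace_add, Complex.add_re]
  linarith

theorem sub (h : PosSplit M r) (h' : PosSplit N t) : PosSplit (M - N) (r + t) := by
  rw [sub_eq_add_neg]
  exact h.add h'.neg

theorem of_posSemidef (h : M.PosSemidef) : PosSplit M M.trace.re :=
  ⟨M, 0, h, .zero, by simp, by simp⟩

theorem zero : PosSplit (0 : Matrix n n ℂ) 0 := by
  simpa using of_posSemidef (.zero : (0 : Matrix n n ℂ).PosSemidef)

theorem smul_nonneg {c : ℝ} (hc : 0 ≤ c) (h : PosSplit M r) : PosSplit ((c : ℂ) • M) (c * r) := by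
  obtain ⟨X, Y, hX, hY, rfl, hr⟩ := h
  refine ⟨(c : ℂ) • X, (c : ℂ) • Y, hX.smul (by exact_mod_cast hc), hY.smul (by exact_mod_cast hc),
    smul_sub _ _ _, ?_⟩
  simp only [Matrix.trace_smul, smul_eq_mul, Complex.re_ofReal_mul, ← mul_add]
  exact mul_le_mul_of_nonneg_left hr hc

theorem smul (c : ℝ) (h : PosSplit M r) : PosSplit ((c : ℂ) • M) (|c| * r) := by
  rcases le_total 0 c with hc | hc
  · simpa [abs_of_nonneg hc] using h.smul_nonneg hc
  · simpa [abs_of_nonpos hc] using (h.smul_nonneg (neg_nonneg.mpr hc)).neg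

theorem sum {ι : Type*} {s : Finset ι} {f : ι → Matrix n n ℂ} {r : ι → ℝ}
    (h : ∀ i ∈ s, PosSplit (f i) (r i)) : PosSplit (∑ i ∈ s, f i) (∑ i ∈ s, r i) := by
  classical
  induction s using Finset.induction_on with
  | empty => simpa using zero
  | insert a s ha ih =>
    rw [Finset.sum_insert ha, Finset.sum_insert ha]
    exact (h a (Finset.mem_insert_self _ _)).add
      (ih fun i hi => h i (Finset.mem_insert_of_mem hi))

end PosSplit

theorem re_trace_vecMulVec_star (v : n → ℂ) :
    (Matrix.vecMulVec v (star v)).trace.re = ∑ i, ‖v i‖ ^ 2 := by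
  simp only [Matrix.trace, Matrix.diag, Matrix.vecMulVec_apply, Pi.star_apply, Complex.re_sum]
  refine Finset.sum_congr rfl fun i _ => ?_
  rw [Complex.star_def, Complex.mul_conj, Complex.ofReal_re, Complex.normSq_eq_norm_sq]

/-- The cross terms `|u⟩⟨v| + |v⟩⟨u|` split with total trace `t‖u‖² + t⁻¹‖v‖²`. -/
theorem posSplit_cross (u v : n → ℂ) {t : ℝ} (ht : 0 < t) :
    PosSplit (Matrix.vecMulVec u (star v) + Matrix.vecMulVec v (star u))
      (t * ∑ i, ‖u i‖ ^ 2 + t⁻¹ * ∑ i, ‖v i‖ ^ 2) := by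
  have h0 : (t : ℂ) ≠ 0 := by exact_mod_cast ht.ne'
  -- Polarization: the cross terms are `(2t)⁻¹` times the difference of the rank-one matrices of `t
  -- u + v` and `t u - v`; the parallelogram law then gives the trace.
  have key := ((PosSplit.of_posSemidef
      (Matrix.posSemidef_vecMulVec_self_star (((t : ℝ) : ℂ) • u + v))).smul_nonneg
        (c := (2 * t)⁻¹) (by positivity)).sub
    ((PosSplit.of_posSemidef
      (Matrix.posSemidef_vecMulVec_self_star (((t : ℝ) : ℂ) • u - v))).smul_nonneg
        (c := (2 * t)⁻¹) (by positivity))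
  have hM : ((((2 * t)⁻¹ : ℝ) : ℂ) • Matrix.vecMulVec ((t : ℂ) • u + v) (star ((t : ℂ) • u + v)) -
      (((2 * t)⁻¹ : ℝ) : ℂ) • Matrix.vecMulVec ((t : ℂ) • u - v) (star ((t : ℂ) • u - v))) =
      Matrix.vecMulVec u (star v) + Matrix.vecMulVec v (star u) := by
    ext i j
    simp [Matrix.vecMulVec_apply]
    field_simp
    ring
  rw [hM] at key
  refine key.mono (le_of_eq ?_)
  rw [re_trace_vecMulVec_star, re_trace_vecMulVec_star, ← mul_add, ← Finset.sum_add_distrib]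
  have : ∀ i, ‖((t : ℂ) • u + v) i‖ ^ 2 + ‖((t : ℂ) • u - v) i‖ ^ 2 =
      2 * t ^ 2 * ‖u i‖ ^ 2 + 2 * ‖v i‖ ^ 2 := by
    intro i
    have := parallelogram_law_with_norm ℝ ((t : ℂ) * u i) (v i)
    simp only [Pi.add_apply, Pi.sub_apply, Pi.smul_apply, smul_eq_mul]
    rw [norm_mul, Complex.norm_real, Real.norm_of_nonneg ht.le] at this
    nlinarith
  simp only [this, Finset.sum_add_distrib, ← Finset.mul_sum]
  field_simp

end TraceNorm

/-! ### Collision probabilities and tuples of distinct indices -/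

section Collision

variable {d : ℕ}

theorem sum_prod_apply_eq_one (w : Fin d → ℝ) (h1 : ∑ x, w x = 1) (k : ℕ) :
    ∑ i : Fin k → Fin d, ∏ a, w (i a) = 1 := by
  have := Finset.prod_univ_sum (fun _ : Fin k => (Finset.univ : Finset (Fin d))) (fun _ x => w x)
  rw [Fintype.piFinset_univ] at this
  rw [← this]
  simp [h1]

theorem sum_prod_apply_of_apply_eq (w : Fin d → ℝ) (h1 : ∑ x, w x = 1) {k : ℕ} {a b : Fin k}
    (hab : a ≠ b) :
    ∑ i : Fin k → Fin d, (if i a = i b then ∏ c, w (i c) else 0) = ∑ x, w x ^ 2 := by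
  classical
  -- Fixing the common value `x` at positions `a` and `b` makes the sum factor over positions: `w x`
  -- at these two, `1` at all others.
  have hx : ∀ x : Fin d, ∑ i : Fin k → Fin d,
      (∏ c, if c = a ∨ c = b then (if i c = x then w (i c) else 0) else w (i c)) = w x ^ 2 := by
    intro x
    have := Finset.prod_univ_sum (fun _ : Fin k => (Finset.univ : Finset (Fin d)))
      (fun c y => if c = a ∨ c = b then (if y = x then w y else 0) else w y)
    rw [Fintype.piFinset_univ] at this
    rw [← this]
    have h2 : ∀ c : Fin k, (∑ y, if c = a ∨ c = b then (if y = x then w y else 0) else w y) =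
        if c ∈ ({a, b} : Finset (Fin k)) then w x else 1 := by
      intro c
      by_cases hc : c = a ∨ c = b <;> simp [hc, h1]
    simp only [h2, Finset.prod_ite_mem, Finset.univ_inter]
    rw [Finset.prod_pair hab, pow_two]
  rw [← Finset.sum_congr rfl fun x _ => hx x, Finset.sum_comm]
  refine Finset.sum_congr rfl fun i _ => ?_
  split_ifs with h
  · rw [Finset.sum_eq_single (i a)]
    · refine Finset.prod_congr rfl fun c _ => ?_
      by_cases hc : c = a ∨ c = b
      · rw [if_pos hc, if_pos]
        rcases hc with rfl | rfl
        · rfl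
        · exact h.symm
      · rw [if_neg hc]
    · intro x _ hxa
      exact Finset.prod_eq_zero (Finset.mem_univ a) (by simp [hxa.symm])
    · simp
  · symm
    refine Finset.sum_eq_zero fun x _ => ?_
    by_cases hxa : i a = x
    · refine Finset.prod_eq_zero (Finset.mem_univ b) ?_
      have : i b ≠ x := fun hb => h (hxa.trans hb.symm)
      simp [this]
    · exact Finset.prod_eq_zero (Finset.mem_univ a) (by simp [hxa])

/-- Union bound: `k` independent samples from the distribution `w` collide with probability at most
`k ^ 2 * ∑ x, w x ^ 2`. -/
theorem sum_prod_apply_not_injective_le (w : Fin d → ℝ) (h0 : ∀ x, 0 ≤ w x) (h1 : ∑ x, w x = 1)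
    (k : ℕ) [DecidablePred fun i : Fin k → Fin d => Function.Injective i] :
    ∑ i : Fin k → Fin d, (if Function.Injective i then 0 else ∏ a, w (i a)) ≤
      (k : ℝ) ^ 2 * ∑ x, w x ^ 2 := by
  classical
  have hp : ∀ i : Fin k → Fin d, 0 ≤ ∏ a, w (i a) := fun i => Finset.prod_nonneg fun a _ => h0 _
  calc ∑ i : Fin k → Fin d, (if Function.Injective i then 0 else ∏ a, w (i a))
      ≤ ∑ i : Fin k → Fin d, ∑ p ∈ (Finset.univ : Finset (Fin k × Fin k)).filter
          (fun p => p.1 ≠ p.2), (if i p.1 = i p.2 then ∏ c, w (i c) else 0) := by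
        refine Finset.sum_le_sum fun i _ => ?_
        have hn : ∀ p ∈ (Finset.univ : Finset (Fin k × Fin k)).filter (fun p => p.1 ≠ p.2),
            0 ≤ (if i p.1 = i p.2 then ∏ c, w (i c) else 0) := by
          intro p _
          split_ifs
          · exact hp i
          · exact le_rfl
        split_ifs with h
        · exact Finset.sum_nonneg hn
        · rw [Function.not_injective_iff] at h
          obtain ⟨a, b, hab, hne⟩ := h
          refine le_trans ?_ (Finset.single_le_sum hn (a := (a, b)) (by simpa using hne))
          simp [hab]
    _ = ∑ p ∈ (Finset.univ : Finset (Fin k × Fin k)).filter (fun p => p.1 ≠ p.2),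
          ∑ x, w x ^ 2 := by
        rw [Finset.sum_comm]
        refine Finset.sum_congr rfl fun p hp => ?_
        exact sum_prod_apply_of_apply_eq w h1 (Finset.mem_filter.mp hp).2
    _ ≤ (k : ℝ) ^ 2 * ∑ x, w x ^ 2 := by
        rw [Finset.sum_const, nsmul_eq_mul]
        refine mul_le_mul_of_nonneg_right ?_ (Finset.sum_nonneg fun x _ => sq_nonneg _)
        have : ((Finset.univ : Finset (Fin k × Fin k)).filter (fun p => p.1 ≠ p.2)).card ≤
            k ^ 2 := (Finset.card_filter_le _ _).trans (by simp [pow_two])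
        exact_mod_cast this

/-- The matrix whose `(i, j)` entry is `1` when `i` and `j` are injective tuples with the same set
of values, and `0` otherwise: up to a factor, the projector onto the span of the symmetrizations of
tuples of distinct basis vectors. -/
noncomputable def distinctSym (d k : ℕ) : Matrix (Fin k → Fin d) (Fin k → Fin d) ℂ :=
  open scoped Classical in
  Matrix.of fun i j => if Function.Injective i ∧ Function.Injective j ∧ Set.range i = Set.range j
    then 1 else 0

theorem card_injective (d k : ℕ) [DecidablePred fun i : Fin k → Fin d => Function.Injective i] :
    ((Finset.univ : Finset (Fin k → Fin d)).filter Function.Injective).card =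
      d.descFactorial k := by
  have h := Fintype.card_embedding_eq (α := Fin k) (β := Fin d)
  rw [Fintype.card_fin, Fintype.card_fin] at h
  rw [← h, ← Fintype.card_subtype]
  exact Fintype.card_congr (Equiv.subtypeInjectiveEquivEmbedding _ _)

theorem re_trace_distinctSym (d k : ℕ) : (distinctSym d k).trace.re = d.descFactorial k := by
  classical
  rw [← card_injective]
  simp [Matrix.trace, distinctSym]

theorem distinctSym_posSemidef (d k : ℕ) : (distinctSym d k).PosSemidef := by
  classical
  have h : distinctSym d k = ∑ A : Set (Fin d), Matrix.vecMulVec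
      (fun i : Fin k → Fin d => if Function.Injective i ∧ Set.range i = A then (1 : ℂ) else 0)
      (star fun i : Fin k → Fin d =>
        if Function.Injective i ∧ Set.range i = A then (1 : ℂ) else 0) := by
    ext i j
    rw [Matrix.sum_apply, Finset.sum_eq_single (Set.range i)]
    · by_cases hi : Function.Injective i <;> by_cases hj : Function.Injective j <;>
        by_cases hr : Set.range i = Set.range j <;>
        simp [distinctSym, Matrix.vecMulVec_apply, hi, hj, hr, eq_comm]
    · intro A _ hA
      simp [Matrix.vecMulVec_apply, hA.symm]
    · simp
  rw [h]
  exact Matrix.posSemidef_sum _ fun A _ => Matrix.posSemidef_vecMulVec_self_star _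

end Collision

/-! ### Positivity of averaged rank-one matrices -/

section IntegralRankOne

/-- The quadratic form at `x` is the integral of `|∑ᵢ x̄ᵢ vᵢ|²`. -/
theorem posSemidef_integral_vecMulVec {n α : Type*} [Fintype n] [MeasurableSpace α]
    {μ : Measure α} (v : n → α → ℂ) (hv : ∀ i j, Integrable (fun ω => v i ω * star (v j ω)) μ) :
    (Matrix.of fun i j => ∫ ω, v i ω * star (v j ω) ∂μ).PosSemidef := by
  refine Matrix.PosSemidef.of_dotProduct_mulVec_nonneg ?_ fun x => ?_
  · ext i j
    simp only [Matrix.conjTranspose_apply, Matrix.of_apply]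
    rw [Complex.star_def, ← integral_conj]
    simp [mul_comm]
  · have h : star x ⬝ᵥ ((Matrix.of fun i j => ∫ ω, v i ω * star (v j ω) ∂μ) *ᵥ x) =
        ∫ ω, ((‖∑ i, star (x i) * v i ω‖ ^ 2 : ℝ) : ℂ) ∂μ := by
      have h2 : ∀ ω, ((‖∑ i, star (x i) * v i ω‖ ^ 2 : ℝ) : ℂ) =
          ∑ i, ∑ j, star (x i) * ((v i ω * star (v j ω)) * x j) := by
        intro ω
        rw [← Complex.normSq_eq_norm_sq, ← Complex.mul_conj, map_sum, Finset.sum_mul_sum]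
        refine Finset.sum_congr rfl fun i _ => Finset.sum_congr rfl fun j _ => ?_
        simp
        ring
      simp only [h2]
      rw [integral_finsetSum]
      · simp only [dotProduct, Matrix.mulVec, Matrix.of_apply, Finset.mul_sum]
        refine Finset.sum_congr rfl fun i _ => ?_
        rw [integral_finsetSum]
        · refine Finset.sum_congr rfl fun j _ => ?_
          rw [integral_const_mul, integral_mul_const]
          rfl
        · exact fun j _ => ((hv i j).mul_const _).const_mul _
      · exact fun i _ => integrable_finsetSum _ fun j _ => ((hv i j).mul_const _).const_mul _
    rw [h, integral_complex_ofReal]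
    exact_mod_cast integral_nonneg fun ω => sq_nonneg _

end IntegralRankOne

/-! ### Fourth moments and collisions of a Haar random state -/

section Haar

variable {d : ℕ}

theorem integrable_haarState_of_continuous {F : Type*} [NormedAddCommGroup F] (hd : 1 ≤ d)
    {f : Metric.sphere (0 : EuclideanSpace ℂ (Fin d)) 1 → F} (hf : Continuous f) :
    Integrable f (haarState d) := by
  have := haarState_isProbabilityMeasure d hd
  have : CompactSpace (Metric.sphere (0 : EuclideanSpace ℂ (Fin d)) 1) :=
    isCompact_iff_compactSpace.mp (isCompact_sphere _ _)
  exact hf.integrable_of_hasCompactSupport (HasCompactSupport.of_compactSpace _)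

theorem integral_haarState_unitary {F : Type*} [NormedAddCommGroup F] [NormedSpace ℝ F]
    (U : EuclideanSpace ℂ (Fin d) ≃ₗᵢ[ℂ] EuclideanSpace ℂ (Fin d))
    {f : Metric.sphere (0 : EuclideanSpace ℂ (Fin d)) 1 → F} (hf : Continuous f) :
    ∫ ψ, f (unitaryOnSphere U ψ) ∂(haarState d) = ∫ ψ, f ψ ∂(haarState d) := by
  have hm : Measurable (unitaryOnSphere U) :=
    (U.continuous.measurable.comp measurable_subtype_coe).subtype_mk
  conv_rhs => rw [← haarState_map_unitary U]
  exact (integral_map hm.aemeasurable (hf.aestronglyMeasurable_of_compactSpace)).symm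

theorem sum_norm_sq_sphere (ψ : Metric.sphere (0 : EuclideanSpace ℂ (Fin d)) 1) :
    ∑ x, ‖ψ.1 x‖ ^ 2 = 1 := by
  rw [← EuclideanSpace.norm_sq_eq, norm_eq_of_mem_sphere ψ, one_pow]

theorem integral_norm_inner_pow_four {u : EuclideanSpace ℂ (Fin d)} (hu : ‖u‖ = 1) (x : Fin d) :
    ∫ ψ, ‖inner ℂ u ψ.1‖ ^ 4 ∂(haarState d) = ∫ ψ, ‖ψ.1 x‖ ^ 4 ∂(haarState d) := by
  -- Complete `u` to an orthonormal basis with `u` in position `x`; its coordinate map is a unitary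
  -- sending the coefficient along `u` to coordinate `x`.
  obtain ⟨b, hb⟩ := Orthonormal.exists_orthonormalBasis_extension_of_card_eq
    (𝕜 := ℂ) (E := EuclideanSpace ℂ (Fin d)) (ι := Fin d) (by simp) (v := fun _ => u) (s := {x})
    ⟨fun _ => hu, fun i j hij => absurd (Subsingleton.elim i j) hij⟩
  rw [← integral_haarState_unitary b.repr (f := fun ψ => ‖ψ.1 x‖ ^ 4) (by fun_prop)]
  refine integral_congr_ae (.of_forall fun ψ => ?_)
  simp only [unitaryOnSphere, b.repr_apply_apply, hb x rfl]

/-- Summing over the fourth roots of unity cancels the cross terms that depend on the relative phase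
of `a` and `b`. -/
theorem sum_norm_add_phase_pow_four (a b : ℂ) :
    ‖a + b‖ ^ 4 + ‖a - b‖ ^ 4 + ‖a + Complex.I * b‖ ^ 4 + ‖a - Complex.I * b‖ ^ 4 =
      4 * (‖a‖ ^ 4 + ‖b‖ ^ 4 + 4 * (‖a‖ ^ 2 * ‖b‖ ^ 2)) := by
  have h : ∀ z : ℂ, ‖z‖ ^ 4 = (z.re * z.re + z.im * z.im) ^ 2 := by
    intro z
    rw [← Complex.normSq_apply, Complex.normSq_eq_norm_sq]
    ring
  have h2 : ∀ z : ℂ, ‖z‖ ^ 2 = z.re * z.re + z.im * z.im := by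
    intro z
    rw [← Complex.normSq_apply, Complex.normSq_eq_norm_sq]
  simp only [h, h2]
  simp
  ring

/-- The integrand is `√2 ^ 4` times the fourth power of a coefficient along a unit vector, and all
unit vectors have the same fourth moment. -/
theorem integral_norm_add_phase_pow_four {x y : Fin d} (hxy : x ≠ y) {ω : ℂ} (hω : ‖ω‖ = 1) :
    ∫ ψ, ‖ψ.1 x + ω * ψ.1 y‖ ^ 4 ∂(haarState d) = 4 * ∫ ψ, ‖ψ.1 x‖ ^ 4 ∂(haarState d) := by
  let u : EuclideanSpace ℂ (Fin d) := ((√2 : ℝ) : ℂ)⁻¹ •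
    (EuclideanSpace.single x 1 + EuclideanSpace.single y (star ω))
  have hin : ∀ v : EuclideanSpace ℂ (Fin d), inner ℂ u v = ((√2 : ℝ) : ℂ)⁻¹ * (v x + ω * v y) := by
    intro v
    simp [u, EuclideanSpace.inner_single_left]
    ring
  have hu : ‖u‖ = 1 := by
    have h2 : ((√2 : ℝ) : ℂ) ^ 2 = 2 := by
      rw [← Complex.ofReal_pow, Real.sq_sqrt (by norm_num)]
      norm_num
    have h3 : ω * star ω = 1 := by
      rw [Complex.star_def, Complex.mul_conj, Complex.normSq_eq_norm_sq, hω]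
      norm_num
    have h1 : inner ℂ u u = 1 := by
      rw [hin]
      simp only [u, PiLp.smul_apply, PiLp.add_apply, PiLp.single_apply, smul_eq_mul,
        if_neg hxy, if_neg hxy.symm, if_true, add_zero, zero_add]
      have : ((√2 : ℝ) : ℂ) ≠ 0 := by
        intro h
        rw [h] at h2
        norm_num at h2
      field_simp
      rw [h3, h2]
      norm_num
    have h4 : ‖u‖ ^ 2 = 1 := by
      rw [← inner_self_eq_norm_sq (𝕜 := ℂ), h1]
      simp
    nlinarith [norm_nonneg u]
  rw [← integral_norm_inner_pow_four hu x, ← integral_const_mul]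
  refine integral_congr_ae (.of_forall fun ψ => ?_)
  have h4 : √2 ^ 4 = (4 : ℝ) := by
    rw [show (4 : ℕ) = 2 * 2 by norm_num, pow_mul, Real.sq_sqrt (by norm_num)]
    norm_num
  simp only [hin, norm_mul, norm_inv, Complex.norm_real, Real.norm_of_nonneg (Real.sqrt_nonneg 2),
    mul_pow, inv_pow, h4]
  ring

theorem integral_norm_pow_four_eq (x y : Fin d) :
    ∫ ψ, ‖ψ.1 x‖ ^ 4 ∂(haarState d) = ∫ ψ, ‖ψ.1 y‖ ^ 4 ∂(haarState d) := by
  rw [← integral_norm_inner_pow_four (u := EuclideanSpace.single x 1) (by simp) y]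
  simp [EuclideanSpace.inner_single_left]

/-- With `F` the left side and `G` the mixed moment, integrating the phase identity gives `16 F = 4
(2 F + 4 G)`. -/
theorem integral_norm_pow_four_eq_two_mul (hd : 1 ≤ d) {x y : Fin d} (hxy : x ≠ y) :
    ∫ ψ, ‖ψ.1 x‖ ^ 4 ∂(haarState d) = 2 * ∫ ψ, ‖ψ.1 x‖ ^ 2 * ‖ψ.1 y‖ ^ 2 ∂(haarState d) := by
  have e1 := integral_norm_add_phase_pow_four hxy (ω := 1) (by simp)
  have e2 := integral_norm_add_phase_pow_four hxy (ω := -1) (by simp)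
  have e3 := integral_norm_add_phase_pow_four hxy (ω := Complex.I) (by simp)
  have e4 := integral_norm_add_phase_pow_four hxy (ω := -Complex.I) (by simp)
  simp only [one_mul, neg_mul, ← sub_eq_add_neg] at e1 e2 e3 e4
  have hs := congrArg (fun f => ∫ ψ, f ψ ∂(haarState d)) (funext fun
    ψ : Metric.sphere (0 : EuclideanSpace ℂ (Fin d)) 1 =>
      sum_norm_add_phase_pow_four (ψ.1 x) (ψ.1 y))
  simp only at hs
  rw [integral_add (integrable_haarState_of_continuous hd (by fun_prop))
      (integrable_haarState_of_continuous hd (by fun_prop)),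
    integral_add (integrable_haarState_of_continuous hd (by fun_prop))
      (integrable_haarState_of_continuous hd (by fun_prop)),
    integral_add (integrable_haarState_of_continuous hd (by fun_prop))
      (integrable_haarState_of_continuous hd (by fun_prop)), e1, e2, e3, e4, integral_const_mul,
    integral_add (integrable_haarState_of_continuous hd (by fun_prop))
      (integrable_haarState_of_continuous hd (by fun_prop)),
    integral_add (integrable_haarState_of_continuous hd (by fun_prop))
      (integrable_haarState_of_continuous hd (by fun_prop)), integral_const_mul,
    integral_norm_pow_four_eq y x] at hs
  linarith

theorem sum_integral_norm_pow_four_le (hd : 1 ≤ d) :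
    ∑ x, ∫ ψ, ‖ψ.1 x‖ ^ 4 ∂(haarState d) ≤ 2 / d := by
  have := haarState_isProbabilityMeasure d hd
  set F := ∫ ψ, ‖ψ.1 (⟨0, hd⟩ : Fin d)‖ ^ 4 ∂(haarState d)
  have hFx : ∀ x : Fin d, ∫ ψ, ‖ψ.1 x‖ ^ 4 ∂(haarState d) = F :=
    fun x => integral_norm_pow_four_eq _ _
  have h1 : ∑ x : Fin d, ∑ y : Fin d,
      ∫ ψ, ‖ψ.1 x‖ ^ 2 * ‖ψ.1 y‖ ^ 2 ∂(haarState d) = 1 := by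
    have : ∀ ψ : Metric.sphere (0 : EuclideanSpace ℂ (Fin d)) 1,
        ∑ x, ∑ y, ‖ψ.1 x‖ ^ 2 * ‖ψ.1 y‖ ^ 2 = 1 := by
      intro ψ
      rw [← Finset.sum_mul_sum, sum_norm_sq_sphere, one_mul]
    have h2 : ∫ ψ : Metric.sphere (0 : EuclideanSpace ℂ (Fin d)) 1,
        ∑ x, ∑ y, ‖ψ.1 x‖ ^ 2 * ‖ψ.1 y‖ ^ 2 ∂(haarState d) = 1 := by
      simp [this]
    refine Eq.trans ?_ h2
    rw [integral_finsetSum _ fun x _ =>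
      integrable_haarState_of_continuous hd (by fun_prop)]
    refine Finset.sum_congr rfl fun x _ => ?_
    rw [integral_finsetSum _ fun y _ => integrable_haarState_of_continuous hd (by fun_prop)]
  have h2 : ∀ x y : Fin d, ∫ ψ, ‖ψ.1 x‖ ^ 2 * ‖ψ.1 y‖ ^ 2 ∂(haarState d) =
      F / 2 + if x = y then F / 2 else 0 := by
    intro x y
    by_cases hxy : x = y
    · subst hxy
      rw [if_pos rfl, ← hFx x, add_halves]
      refine integral_congr_ae (.of_forall fun ψ => ?_)
      simp only
      ring
    · rw [if_neg hxy, ← hFx x, integral_norm_pow_four_eq_two_mul hd hxy]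
      ring
  simp only [h2, Finset.sum_add_distrib, Finset.sum_const, Finset.card_univ, Fintype.card_fin,
    Finset.sum_ite_eq, Finset.mem_univ, if_true, nsmul_eq_mul] at h1
  simp only [hFx, Finset.sum_const, Finset.card_univ, Fintype.card_fin, nsmul_eq_mul]
  have hd0 : (0 : ℝ) < d := by exact_mod_cast hd
  have hF0 : 0 ≤ F := integral_nonneg fun ψ => by positivity
  -- By now `h1` says `d (d + 1) F / 2 = 1`, so the sum `d F` equals `2 / (d + 1)`.
  rw [le_div_iff₀ hd0]
  nlinarith

/-- The probability that measuring `k` copies of a Haar random state yields the outcomes `i`. -/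
noncomputable def haarOutcome (d k : ℕ) (i : Fin k → Fin d) : ℝ :=
  ∫ ψ, ∏ a, ‖ψ.1 (i a)‖ ^ 2 ∂(haarState d)

theorem haarMoment_apply (k : ℕ) (i j : Fin k → Fin d) :
    haarMoment d k i j = ∫ ψ, (∏ a, ψ.1 (i a)) * star (∏ a, ψ.1 (j a)) ∂(haarState d) := by
  simp [haarMoment, tensorPower, ketBra, Finset.prod_mul_distrib]

theorem haarMoment_apply_self (k : ℕ) (i : Fin k → Fin d) :
    haarMoment d k i i = haarOutcome d k i := by
  rw [haarMoment_apply, haarOutcome, ← integral_complex_ofReal]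
  refine integral_congr_ae (.of_forall fun ψ => ?_)
  simp only [Complex.star_def, Complex.mul_conj, Complex.normSq_eq_norm_sq, norm_prod,
    Finset.prod_pow]

theorem sum_haarOutcome (hd : 1 ≤ d) (k : ℕ) : ∑ i, haarOutcome d k i = 1 := by
  have := haarState_isProbabilityMeasure d hd
  simp only [haarOutcome]
  rw [← integral_finsetSum _ fun i _ => integrable_haarState_of_continuous hd (by fun_prop)]
  have : ∀ ψ : Metric.sphere (0 : EuclideanSpace ℂ (Fin d)) 1,
      ∑ i : Fin k → Fin d, ∏ a, ‖ψ.1 (i a)‖ ^ 2 = 1 :=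
    fun ψ => sum_prod_apply_eq_one (fun x => ‖ψ.1 x‖ ^ 2) (sum_norm_sq_sphere ψ) k
  simp [this]

theorem sum_haarOutcome_not_injective_le (hd : 1 ≤ d) (k : ℕ)
    [DecidablePred fun i : Fin k → Fin d => Function.Injective i] :
    ∑ i, (if Function.Injective i then 0 else haarOutcome d k i) ≤ 2 * ((k : ℝ) ^ 2 / d) := by
  calc ∑ i, (if Function.Injective i then 0 else haarOutcome d k i)
      = ∫ ψ, ∑ i : Fin k → Fin d, (if Function.Injective i then 0 else ∏ a, ‖ψ.1 (i a)‖ ^ 2)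
          ∂(haarState d) := by
        rw [integral_finsetSum]
        · refine Finset.sum_congr rfl fun i _ => ?_
          split_ifs <;> simp [haarOutcome]
        · intro i _
          split_ifs
          · exact integrable_zero _ _ _
          · exact integrable_haarState_of_continuous hd (by fun_prop)
    _ ≤ ∫ ψ, (k : ℝ) ^ 2 * ∑ x, ‖ψ.1 x‖ ^ 4 ∂(haarState d) := by
        refine integral_mono ?_ (integrable_haarState_of_continuous hd (by fun_prop)) fun ψ => ?_
        · refine integrable_finsetSum _ fun i _ => ?_
          split_ifs
          · exact integrable_zero _ _ _
          · exact integrable_haarState_of_continuous hd (by fun_prop)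
        · have := sum_prod_apply_not_injective_le (fun x => ‖ψ.1 x‖ ^ 2) (fun x => sq_nonneg _)
            (sum_norm_sq_sphere ψ) k
          simp only [← pow_mul] at this
          exact this
    _ ≤ 2 * ((k : ℝ) ^ 2 / d) := by
        rw [integral_const_mul, integral_finsetSum _ fun i _ =>
          integrable_haarState_of_continuous hd (by fun_prop)]
        calc _ ≤ (k : ℝ) ^ 2 * (2 / d) :=
              mul_le_mul_of_nonneg_left (sum_integral_norm_pow_four_le hd) (sq_nonneg _)
          _ = _ := by ring

/-! ### Entries of the Haar moment from its symmetries -/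

theorem haarOutcome_eq_of_injective {k : ℕ} {i j : Fin k → Fin d} (hi : Function.Injective i)
    (hj : Function.Injective j) : haarOutcome d k i = haarOutcome d k j := by
  -- The symmetric group is `k`-transitive, so some permutation of the coordinates carries `i` to
  -- `j`.
  obtain ⟨e, he⟩ := (MulAction.isMultiplyPretransitive_iff.mp
    (Equiv.Perm.isMultiplyPretransitive (Fin d) k)) ⟨i, hi⟩ ⟨j, hj⟩
  have he' : ∀ a, e (i a) = j a := fun a => DFunLike.congr_fun he a
  rw [haarOutcome, haarOutcome, ← integral_haarState_unitary
    (LinearIsometryEquiv.piLpCongrLeft 2 ℂ ℂ e) (f := fun ψ => ∏ a, ‖ψ.1 (j a)‖ ^ 2)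
    (by fun_prop)]
  refine integral_congr_ae (.of_forall fun ψ => ?_)
  refine Finset.prod_congr rfl fun a _ => ?_
  simp [unitaryOnSphere, ← he', LinearIsometryEquiv.piLpCongrLeft_apply]

theorem prod_apply_eq_of_range_eq {k : ℕ} {i j : Fin k → Fin d} (hi : Function.Injective i)
    (hj : Function.Injective j) (hr : Set.range i = Set.range j) (f : Fin d → ℂ) :
    ∏ a, f (i a) = ∏ a, f (j a) := by
  classical
  have h : Finset.univ.image i = Finset.univ.image j := by
    apply Finset.coe_injective
    simpa using hr
  rw [← Finset.prod_image (s := Finset.univ) (f := f) (g := i) (fun a _ b _ hab => hi hab), h,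
    Finset.prod_image fun a _ b _ hab => hj hab]

theorem haarMoment_apply_of_range_eq {k : ℕ} {i j : Fin k → Fin d} (hi : Function.Injective i)
    (hj : Function.Injective j) (hr : Set.range i = Set.range j) :
    haarMoment d k i j = haarOutcome d k i := by
  rw [← haarMoment_apply_self, haarMoment_apply, haarMoment_apply]
  simp only [prod_apply_eq_of_range_eq hi hj hr]

/-- Negating coordinate `x` is unitary and multiplies the integrand by `-1`. -/
theorem haarMoment_apply_eq_zero_of_sign {k : ℕ} {i j : Fin k → Fin d} (x : Fin d)
    (h : (∏ a, if i a = x then (-1 : ℂ) else 1) * (∏ a, if j a = x then (-1 : ℂ) else 1) = -1) :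
    haarMoment d k i j = 0 := by
  have key : haarMoment d k i j = -haarMoment d k i j := by
    conv_lhs => rw [haarMoment_apply, ← integral_haarState_unitary
      (LinearIsometryEquiv.piLpCongrRight 2 (fun y : Fin d =>
        if y = x then LinearIsometryEquiv.neg ℂ else LinearIsometryEquiv.refl ℂ ℂ))
      (f := fun ψ => (∏ a, ψ.1 (i a)) * star (∏ a, ψ.1 (j a))) (by fun_prop)]
    rw [haarMoment_apply, ← integral_neg]
    refine integral_congr_ae (.of_forall fun ψ => ?_)
    have hc : ∀ y, (unitaryOnSphere (LinearIsometryEquiv.piLpCongrRight 2 (fun y : Fin d =>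
        if y = x then LinearIsometryEquiv.neg ℂ else LinearIsometryEquiv.refl ℂ ℂ)) ψ).1 y =
        (if y = x then (-1 : ℂ) else 1) * ψ.1 y := by
      intro y
      by_cases hy : y = x <;> simp [unitaryOnSphere, hy]
    have hs : star (∏ a, if j a = x then (-1 : ℂ) else 1) =
        ∏ a, if j a = x then (-1 : ℂ) else 1 := by
      rw [star_prod]
      refine Finset.prod_congr rfl fun a _ => ?_
      split_ifs <;> simp
    simp only [hc, Finset.prod_mul_distrib, star_mul', hs]
    linear_combination (∏ a, ψ.1 (i a)) * star (∏ a, ψ.1 (j a)) * h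
  have : (2 : ℂ) * haarMoment d k i j = 0 := by linear_combination key
  simpa using this

theorem prod_sign_of_mem_range {k : ℕ} {i : Fin k → Fin d} (hi : Function.Injective i) {x : Fin d}
    (hx : x ∈ Set.range i) : (∏ a, if i a = x then (-1 : ℂ) else 1) = -1 := by
  obtain ⟨b, rfl⟩ := hx
  simp [hi.eq_iff]

theorem prod_sign_of_notMem_range {k : ℕ} {i : Fin k → Fin d} {x : Fin d}
    (hx : x ∉ Set.range i) : (∏ a, if i a = x then (-1 : ℂ) else 1) = 1 :=
  Finset.prod_eq_one fun a _ => if_neg fun h => hx ⟨a, h⟩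

theorem injective_and_range_eq_of_range_subset {k : ℕ} {i j : Fin k → Fin d}
    (hi : Function.Injective i) (h : Set.range i ⊆ Set.range j) :
    Function.Injective j ∧ Set.range i = Set.range j := by
  classical
  have hci : (Finset.univ.image i).card = k := by
    rw [Finset.card_image_of_injective _ hi, Finset.card_univ, Fintype.card_fin]
  have hcj : (Finset.univ.image j).card ≤ k := by
    simpa using Finset.card_image_le (s := Finset.univ) (f := j)
  have hsub : Finset.univ.image i ⊆ Finset.univ.image j := by
    rw [← Finset.coe_subset]
    simpa using h
  have heq := Finset.eq_of_subset_of_card_le hsub (by omega)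
  refine ⟨?_, ?_⟩
  · have := Finset.card_image_iff.mp
      (by rw [← heq, hci, Finset.card_univ, Fintype.card_fin])
    simpa using this
  · have := congrArg (fun s : Finset (Fin d) => (s : Set (Fin d))) heq
    simpa using this

/-- If one index is injective and the entry is not of the `distinctSym` type, some value `x` occurs
exactly once in that index and never in the other, so the sign flip at `x` kills the Haar entry. -/
theorem haarMoment_sub_apply {k : ℕ} {h : ℝ}
    (hh : ∀ i : Fin k → Fin d, Function.Injective i → haarOutcome d k i = h)
    (i j : Fin k → Fin d) [Decidable (Function.Injective i)] [Decidable (Function.Injective j)] :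
    (haarMoment d k - (h : ℂ) • distinctSym d k) i j =
      if Function.Injective i ∨ Function.Injective j then 0 else haarMoment d k i j := by
  simp only [Matrix.sub_apply, Matrix.smul_apply, distinctSym, Matrix.of_apply, smul_eq_mul]
  by_cases hij : Function.Injective i ∧ Function.Injective j ∧ Set.range i = Set.range j
  · rw [if_pos hij, if_pos (Or.inl hij.1), haarMoment_apply_of_range_eq hij.1 hij.2.1 hij.2.2,
      hh i hij.1]
    simp
  · rw [if_neg hij, mul_zero, sub_zero]
    split_ifs with hor
    · rcases hor with hi | hj
      · have : ¬ Set.range i ⊆ Set.range j := fun hs =>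
          hij ⟨hi, injective_and_range_eq_of_range_subset hi hs⟩
        obtain ⟨x, hxi, hxj⟩ := Set.not_subset.mp this
        refine haarMoment_apply_eq_zero_of_sign x ?_
        rw [prod_sign_of_mem_range hi hxi, prod_sign_of_notMem_range hxj, mul_one]
      · have : ¬ Set.range j ⊆ Set.range i := fun hs =>
          have h2 := injective_and_range_eq_of_range_subset hj hs
          hij ⟨h2.1, hj, h2.2.symm⟩
        obtain ⟨x, hxj, hxi⟩ := Set.not_subset.mp this
        refine haarMoment_apply_eq_zero_of_sign x ?_
        rw [prod_sign_of_mem_range hj hxj, prod_sign_of_notMem_range hxi, one_mul]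
    · rfl

/-- The difference is itself an averaged rank-one matrix, that of `ψ^{⊗k}` with its injective
entries set to zero. -/
theorem haarMoment_sub_posSemidef (hd : 1 ≤ d) {k : ℕ} {h : ℝ}
    (hh : ∀ i : Fin k → Fin d, Function.Injective i → haarOutcome d k i = h) :
    (haarMoment d k - (h : ℂ) • distinctSym d k).PosSemidef := by
  classical
  have key := posSemidef_integral_vecMulVec (μ := haarState d)
    (fun (i : Fin k → Fin d) ψ => if Function.Injective i then 0 else ∏ a, ψ.1 (i a))
    (fun i j => integrable_haarState_of_continuous hd (by split_ifs <;> fun_prop))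
  convert key using 1
  ext i j
  rw [haarMoment_sub_apply hh, haarMoment_apply, Matrix.of_apply]
  by_cases hi : Function.Injective i <;> by_cases hj : Function.Injective j <;> simp [hi, hj]

theorem re_trace_haarMoment (hd : 1 ≤ d) (k : ℕ) : (haarMoment d k).trace.re = 1 := by
  rw [← sum_haarOutcome hd k]
  simp [Matrix.trace, haarMoment_apply_self]

theorem haarMoment_posSemidef (hd : 1 ≤ d) (k : ℕ) : (haarMoment d k).PosSemidef := by
  have key := posSemidef_integral_vecMulVec (μ := haarState d)
    (fun (i : Fin k → Fin d) ψ => ∏ a, ψ.1 (i a))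
    (fun i j => integrable_haarState_of_continuous hd (by fun_prop))
  convert key using 1
  ext i j
  rw [haarMoment_apply, Matrix.of_apply]

/-- The Haar moment is, up to an error of order `k ^ 2 / d`, the normalized projector onto the
symmetric states of tuples of distinct basis vectors. -/
theorem exists_posSplit_haarMoment_sub (hd : 1 ≤ d) (k : ℕ) : ∃ h : ℝ,
    1 - 2 * ((k : ℝ) ^ 2 / d) ≤ h * d.descFactorial k ∧ h * d.descFactorial k ≤ 1 ∧
    PosSplit (haarMoment d k - (h : ℂ) • distinctSym d k) (2 * ((k : ℝ) ^ 2 / d)) := by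
  classical
  obtain ⟨h, hh⟩ : ∃ h : ℝ, ∀ i : Fin k → Fin d, Function.Injective i → haarOutcome d k i = h := by
    by_cases hex : ∃ i : Fin k → Fin d, Function.Injective i
    · obtain ⟨i, hi⟩ := hex
      exact ⟨_, fun j hj => haarOutcome_eq_of_injective hj hi⟩
    -- Without injective tuples the value of `h` is immaterial, since `d.descFactorial k = 0`.
    · exact ⟨0, fun i hi => absurd ⟨i, hi⟩ hex⟩
  have hsum := sum_haarOutcome hd k
  rw [← Finset.sum_filter_add_sum_filter_not Finset.univ (fun i => Function.Injective i),
    Finset.sum_congr rfl fun i hi => hh i (Finset.mem_filter.mp hi).2, Finset.sum_const,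
    card_injective, nsmul_eq_mul, mul_comm] at hsum
  have hle := sum_haarOutcome_not_injective_le hd k
  simp only [← ite_not (p := Function.Injective _)] at hle
  rw [← Finset.sum_filter] at hle
  have hnn : 0 ≤ ∑ i with ¬ Function.Injective i, haarOutcome d k i :=
    Finset.sum_nonneg fun i _ => integral_nonneg fun ψ => Finset.prod_nonneg fun a _ => sq_nonneg _
  have htr := PosSplit.of_posSemidef (haarMoment_sub_posSemidef hd hh)
  refine ⟨h, by linarith, by linarith, htr.mono ?_⟩
  rw [Matrix.trace_sub, Matrix.trace_smul, smul_eq_mul, Complex.sub_re, Complex.re_ofReal_mul,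
    re_trace_haarMoment hd, re_trace_distinctSym]
  linarith

end Haar

/-! ### Truncating and decomposing the subset moment -/

section SubsetMoment

variable {d : ℕ}

theorem subsetState_apply (S : Finset (Fin d)) (x : Fin d) :
    subsetState S x = if x ∈ S then (((√S.card)⁻¹ : ℝ) : ℂ) else 0 := by
  simp [subsetState]

/-- The vector `v^{⊗k}` in the computational basis. -/
noncomputable def tensorVec (v : EuclideanSpace ℂ (Fin d)) (k : ℕ) (i : Fin k → Fin d) : ℂ :=
  ∏ a, v (i a)

theorem tensorPower_ketBra (v : EuclideanSpace ℂ (Fin d)) (k : ℕ) :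
    tensorPower (ketBra v) k = Matrix.vecMulVec (tensorVec v k) (star (tensorVec v k)) := by
  ext i j
  simp [tensorPower, ketBra, tensorVec, Matrix.vecMulVec_apply, Finset.prod_mul_distrib]

theorem tensorVec_subsetState {k : ℕ} (S : Finset (Fin d)) (i : Fin k → Fin d) :
    tensorVec (subsetState S) k i =
      if Finset.univ.image i ⊆ S then ((((√S.card)⁻¹) ^ k : ℝ) : ℂ) else 0 := by
  simp only [tensorVec, subsetState_apply, Finset.prod_ite_zero, Finset.image_subset_iff]
  simp

theorem sum_norm_sq_subsetState {S : Finset (Fin d)} (hS : 1 ≤ S.card) :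
    ∑ x, ‖subsetState S x‖ ^ 2 = 1 := by
  have h0 : (0 : ℝ) < S.card := by exact_mod_cast hS
  have : ∀ x, ‖subsetState S x‖ ^ 2 = if x ∈ S then (S.card : ℝ)⁻¹ else 0 := by
    intro x
    rw [subsetState_apply]
    split_ifs
    · rw [Complex.norm_real, Real.norm_eq_abs, sq_abs, inv_pow, Real.sq_sqrt h0.le]
    · simp
  simp only [this, Finset.sum_ite_mem, Finset.univ_inter, Finset.sum_const, nsmul_eq_mul]
  exact mul_inv_cancel₀ h0.ne'

theorem sum_norm_pow_four_subsetState {S : Finset (Fin d)} (hS : 1 ≤ S.card) :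
    ∑ x, (‖subsetState S x‖ ^ 2) ^ 2 = (S.card : ℝ)⁻¹ := by
  have h0 : (0 : ℝ) < S.card := by exact_mod_cast hS
  have : ∀ x, (‖subsetState S x‖ ^ 2) ^ 2 = if x ∈ S then ((S.card : ℝ)⁻¹) ^ 2 else 0 := by
    intro x
    rw [subsetState_apply]
    split_ifs
    · rw [Complex.norm_real, Real.norm_eq_abs, sq_abs, inv_pow, Real.sq_sqrt h0.le]
    · simp
  simp only [this, Finset.sum_ite_mem, Finset.univ_inter, Finset.sum_const, nsmul_eq_mul]
  field_simp

theorem sum_norm_sq_tensorVec {v : EuclideanSpace ℂ (Fin d)} (hv : ∑ x, ‖v x‖ ^ 2 = 1) (k : ℕ) :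
    ∑ i, ‖tensorVec v k i‖ ^ 2 = 1 := by
  simp only [tensorVec, norm_prod, ← Finset.prod_pow]
  exact sum_prod_apply_eq_one (fun x => ‖v x‖ ^ 2) hv k

/-- The component of `v^{⊗k}` on tuples of distinct basis vectors. -/
noncomputable def tensorVecDistinct (v : EuclideanSpace ℂ (Fin d)) (k : ℕ) (i : Fin k → Fin d) :
    ℂ :=
  open scoped Classical in if Function.Injective i then tensorVec v k i else 0

theorem sum_norm_sq_tensorVecDistinct_le {v : EuclideanSpace ℂ (Fin d)}
    (hv : ∑ x, ‖v x‖ ^ 2 = 1) (k : ℕ) : ∑ i, ‖tensorVecDistinct v k i‖ ^ 2 ≤ 1 := by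
  rw [← sum_norm_sq_tensorVec hv k]
  refine Finset.sum_le_sum fun i _ => ?_
  rw [tensorVecDistinct]
  split_ifs
  · exact le_rfl
  · simp

theorem sum_norm_sq_tensorVec_sub_le {S : Finset (Fin d)} (hS : 1 ≤ S.card) (k : ℕ) :
    ∑ i, ‖tensorVec (subsetState S) k i - tensorVecDistinct (subsetState S) k i‖ ^ 2 ≤
      (k : ℝ) ^ 2 / S.card := by
  classical
  have h := sum_prod_apply_not_injective_le (fun x => ‖subsetState S x‖ ^ 2)
    (fun x => sq_nonneg _) (sum_norm_sq_subsetState hS) k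
  rw [sum_norm_pow_four_subsetState hS, ← div_eq_mul_inv] at h
  refine (Finset.sum_le_sum fun i _ => ?_).trans h
  rw [tensorVecDistinct]
  split_ifs
  · simp
  · rw [sub_zero, tensorVec, norm_prod, Finset.prod_pow]

/-- Removing the tuples with a repeated entry from `|v⟩⟨v|^{⊗k}` is a gentle operation. -/
theorem posSplit_tensorPower_sub {S : Finset (Fin d)} (hS : 1 ≤ S.card) {k : ℕ} (hk : 1 ≤ k) :
    PosSplit (tensorPower (ketBra (subsetState S)) k -
        Matrix.vecMulVec (tensorVecDistinct (subsetState S) k)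
          (star (tensorVecDistinct (subsetState S) k)))
      (2 * (k / √S.card) + (k : ℝ) ^ 2 / S.card) := by
  have hs0 : (0 : ℝ) < S.card := by exact_mod_cast hS
  have hk0 : (0 : ℝ) < k := by exact_mod_cast hk
  set u := tensorVecDistinct (subsetState S) k with hu
  set w := tensorVec (subsetState S) k with hw
  have h1 : ∑ i, ‖u i‖ ^ 2 ≤ 1 := sum_norm_sq_tensorVecDistinct_le (sum_norm_sq_subsetState hS) k
  have h2 : ∑ i, ‖(w - u) i‖ ^ 2 ≤ (k : ℝ) ^ 2 / S.card := sum_norm_sq_tensorVec_sub_le hS k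
  have hsq := Real.sq_sqrt hs0.le
  have hsp := Real.sqrt_pos.mpr hs0
  -- The weight `t = k / √s` balances `t ‖u‖² ≤ t` against `t⁻¹ ‖w - u‖² ≤ t⁻¹ k² / s`.
  have ht : (0 : ℝ) < k / √S.card := by positivity
  have key := (posSplit_cross u (w - u) ht).add
    (PosSplit.of_posSemidef (Matrix.posSemidef_vecMulVec_self_star (w - u)))
  have hM : tensorPower (ketBra (subsetState S)) k - Matrix.vecMulVec u (star u) =
      Matrix.vecMulVec u (star (w - u)) + Matrix.vecMulVec (w - u) (star u) +
        Matrix.vecMulVec (w - u) (star (w - u)) := by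
    rw [tensorPower_ketBra]
    ext i j
    simp only [Matrix.sub_apply, Matrix.add_apply, Matrix.vecMulVec_apply, Pi.star_apply,
      Pi.sub_apply, star_sub]
    ring
  rw [hM]
  refine key.mono ?_
  rw [re_trace_vecMulVec_star]
  have e1 : k / √S.card * ∑ i, ‖u i‖ ^ 2 ≤ k / √S.card := by
    simpa using mul_le_mul_of_nonneg_left h1 ht.le
  have e2 : (k / √S.card)⁻¹ * ∑ i, ‖(w - u) i‖ ^ 2 ≤ k / √S.card := by
    calc _ ≤ (k / √S.card)⁻¹ * ((k : ℝ) ^ 2 / S.card) :=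
          mul_le_mul_of_nonneg_left h2 (inv_nonneg.mpr ht.le)
      _ = (k / √S.card)⁻¹ * (k / √S.card) ^ 2 := by rw [div_pow, hsq]
      _ = k / √S.card := by field_simp
  linarith

/-- The average over `S` of the part of `φ_S^{⊗k}` supported on tuples of distinct basis vectors. -/
noncomputable def subsetMomentDistinct (d s k : ℕ) : Matrix (Fin k → Fin d) (Fin k → Fin d) ℂ :=
  (((d.choose s : ℝ)⁻¹ : ℝ) : ℂ) • ∑ S ∈ Finset.powersetCard s (Finset.univ : Finset (Fin d)),
    Matrix.vecMulVec (tensorVecDistinct (subsetState S) k)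
      (star (tensorVecDistinct (subsetState S) k))

theorem subsetMoment_eq (d s k : ℕ) : subsetMoment d s k =
    (((d.choose s : ℝ)⁻¹ : ℝ) : ℂ) • ∑ S ∈ Finset.powersetCard s (Finset.univ : Finset (Fin d)),
      tensorPower (ketBra (subsetState S)) k := by
  simp [subsetMoment]

theorem posSplit_average {s k : ℕ} (hsd : s ≤ d)
    {f : Finset (Fin d) → Matrix (Fin k → Fin d) (Fin k → Fin d) ℂ} {r : ℝ}
    (hf : ∀ S : Finset (Fin d), S.card = s → PosSplit (f S) r) :
    PosSplit ((((d.choose s : ℝ)⁻¹ : ℝ) : ℂ) •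
      ∑ S ∈ Finset.powersetCard s (Finset.univ : Finset (Fin d)), f S) r := by
  have h := PosSplit.smul_nonneg (c := (d.choose s : ℝ)⁻¹) (by positivity)
    (PosSplit.sum (s := Finset.powersetCard s (Finset.univ : Finset (Fin d))) (f := f)
      (r := fun _ => r) fun S hS => hf S (Finset.mem_powersetCard.mp hS).2)
  refine h.mono (le_of_eq ?_)
  have : (d.choose s : ℝ) ≠ 0 := by exact_mod_cast (Nat.choose_pos hsd).ne'
  simp [this]

theorem posSplit_subsetMoment_sub {s k : ℕ} (hs : 1 ≤ s) (hsd : s ≤ d) (hk : 1 ≤ k) :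
    PosSplit (subsetMoment d s k - subsetMomentDistinct d s k)
      (2 * (k / √s) + (k : ℝ) ^ 2 / s) := by
  rw [subsetMoment_eq, subsetMomentDistinct, ← smul_sub, ← Finset.sum_sub_distrib]
  refine posSplit_average hsd fun S hS => ?_
  subst hS
  exact posSplit_tensorPower_sub hs hk

theorem posSplit_subsetMoment {s : ℕ} (hs : 1 ≤ s) (hsd : s ≤ d) (k : ℕ) :
    PosSplit (subsetMoment d s k) 1 := by
  rw [subsetMoment_eq]
  refine posSplit_average hsd fun S hS => ?_
  subst hS
  rw [tensorPower_ketBra]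
  refine (PosSplit.of_posSemidef (Matrix.posSemidef_vecMulVec_self_star _)).mono ?_
  rw [re_trace_vecMulVec_star, sum_norm_sq_tensorVec (sum_norm_sq_subsetState hs)]

theorem re_trace_subsetMomentDistinct_le {s : ℕ} (hs : 1 ≤ s) (hsd : s ≤ d) (k : ℕ) :
    (subsetMomentDistinct d s k).trace.re ≤ 1 := by
  have h0 : (0 : ℝ) < d.choose s := by exact_mod_cast Nat.choose_pos hsd
  rw [subsetMomentDistinct, Matrix.trace_smul, smul_eq_mul, Complex.re_ofReal_mul,
    Matrix.trace_sum, Complex.re_sum, inv_mul_le_iff₀ h0]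
  calc _ ≤ ∑ S ∈ Finset.powersetCard s (Finset.univ : Finset (Fin d)), (1 : ℝ) := by
        refine Finset.sum_le_sum fun S hS => ?_
        rw [re_trace_vecMulVec_star]
        refine sum_norm_sq_tensorVecDistinct_le (sum_norm_sq_subsetState ?_) k
        rwa [(Finset.mem_powersetCard.mp hS).2]
    _ = _ := by simp

/-- Complements of the sets counted are the `(d - s)`-subsets of `Mᶜ`. Counting this way covers
`M.card > s` and keeps the lower index independent of `M`, as Vandermonde requires. -/
theorem card_powersetCard_filter_superset {s : ℕ} (hsd : s ≤ d) (M : Finset (Fin d)) :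
    ((Finset.powersetCard s (Finset.univ : Finset (Fin d))).filter (fun S => M ⊆ S)).card =
      (d - M.card).choose (d - s) := by
  have h : (d - M.card).choose (d - s) = (Finset.powersetCard (d - s) Mᶜ).card := by
    rw [Finset.card_powersetCard, Finset.card_compl, Fintype.card_fin]
  rw [h]
  refine Finset.card_nbij' compl compl ?_ ?_ ?_ ?_
  · intro S hS
    obtain ⟨hS, hMS⟩ := Finset.mem_filter.mp hS
    refine Finset.mem_powersetCard.mpr ⟨Finset.compl_subset_compl.mpr hMS, ?_⟩
    rw [Finset.card_compl, Fintype.card_fin, (Finset.mem_powersetCard.mp hS).2]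
  · intro S hS
    obtain ⟨hMS, hS⟩ := Finset.mem_powersetCard.mp hS
    refine Finset.mem_filter.mpr ⟨Finset.mem_powersetCard.mpr ⟨Finset.subset_univ _, ?_⟩, ?_⟩
    · rw [Finset.card_compl, Fintype.card_fin, hS]
      omega
    · exact Finset.subset_compl_comm.mp hMS
  · intro S _
    exact compl_compl S
  · intro S _
    exact compl_compl S

theorem image_univ_eq_iff {k : ℕ} (i j : Fin k → Fin d) :
    Finset.univ.image i = Finset.univ.image j ↔ Set.range i = Set.range j := by
  rw [← Finset.coe_inj]
  simp

theorem card_image_of_injective_tuple {k : ℕ} {i : Fin k → Fin d} (hi : Function.Injective i) :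
    (Finset.univ.image i).card = k := by
  rw [Finset.card_image_of_injective _ hi, Finset.card_univ, Fintype.card_fin]

theorem subsetMomentDistinct_apply {s k : ℕ} (hs : 1 ≤ s) (hsd : s ≤ d) (i j : Fin k → Fin d)
    [Decidable (Function.Injective i ∧ Function.Injective j)] :
    subsetMomentDistinct d s k i j = (((d.choose s : ℝ)⁻¹ * ((s : ℝ) ^ k)⁻¹ : ℝ) : ℂ) *
      if Function.Injective i ∧ Function.Injective j then
        (((d - (Finset.univ.image i ∪ Finset.univ.image j).card).choose (d - s) : ℕ) : ℂ)
      else 0 := by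
  have hs0 : (0 : ℝ) ≤ s := by positivity
  have hterm : ∀ S ∈ Finset.powersetCard s (Finset.univ : Finset (Fin d)),
      Matrix.vecMulVec (tensorVecDistinct (subsetState S) k)
        (star (tensorVecDistinct (subsetState S) k)) i j =
      (((s : ℝ) ^ k)⁻¹ : ℝ) * if Function.Injective i ∧ Function.Injective j then
        (if Finset.univ.image i ∪ Finset.univ.image j ⊆ S then (1 : ℂ) else 0) else 0 := by
    intro S hS
    have hc := (Finset.mem_powersetCard.mp hS).2
    have hpow : ((((√s)⁻¹) ^ k : ℝ) : ℂ) * ((((√s)⁻¹) ^ k : ℝ) : ℂ) = (((s : ℝ) ^ k)⁻¹ : ℝ) := by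
      rw [← Complex.ofReal_mul, ← mul_pow, ← mul_inv, Real.mul_self_sqrt hs0, inv_pow]
    rw [Matrix.vecMulVec_apply, Pi.star_apply, tensorVecDistinct, tensorVecDistinct,
      tensorVec_subsetState, tensorVec_subsetState, hc]
    by_cases hi : Function.Injective i <;> by_cases hj : Function.Injective j <;>
      by_cases h1 : Finset.univ.image i ⊆ S <;> by_cases h2 : Finset.univ.image j ⊆ S <;>
      simp only [hi, hj, h1, h2, Finset.union_subset_iff, if_true, if_false, and_true, and_false,
        mul_zero, zero_mul, star_zero, mul_one]
    rw [Complex.star_def, Complex.conj_ofReal, hpow]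
  rw [subsetMomentDistinct, Matrix.smul_apply, Matrix.sum_apply, Finset.sum_congr rfl hterm,
    ← Finset.mul_sum, smul_eq_mul, Complex.ofReal_mul, mul_assoc]
  congr 2
  split_ifs
  · rw [← card_powersetCard_filter_superset hsd, Finset.sum_boole]
  · simp

/-- The matrix with entries `(#(im i ∩ im j)).choose r` on injective tuples. -/
noncomputable def inclusionGram (d k r : ℕ) : Matrix (Fin k → Fin d) (Fin k → Fin d) ℂ :=
  open scoped Classical in
  ∑ T ∈ Finset.powersetCard r (Finset.univ : Finset (Fin d)), Matrix.vecMulVec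
    (fun i : Fin k → Fin d =>
      if Function.Injective i ∧ T ⊆ Finset.univ.image i then (1 : ℂ) else 0)
    (star fun i : Fin k → Fin d =>
      if Function.Injective i ∧ T ⊆ Finset.univ.image i then (1 : ℂ) else 0)

theorem inclusionGram_posSemidef (d k r : ℕ) : (inclusionGram d k r).PosSemidef :=
  Matrix.posSemidef_sum _ fun _ _ => Matrix.posSemidef_vecMulVec_self_star _

theorem inclusionGram_apply {k r : ℕ} (i j : Fin k → Fin d)
    [Decidable (Function.Injective i ∧ Function.Injective j)] :
    inclusionGram d k r i j = if Function.Injective i ∧ Function.Injective j then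
      (((Finset.univ.image i ∩ Finset.univ.image j).card.choose r : ℕ) : ℂ) else 0 := by
  classical
  have hterm : ∀ T : Finset (Fin d), Matrix.vecMulVec
      (fun i : Fin k → Fin d =>
        if Function.Injective i ∧ T ⊆ Finset.univ.image i then (1 : ℂ) else 0)
      (star fun i : Fin k → Fin d =>
        if Function.Injective i ∧ T ⊆ Finset.univ.image i then (1 : ℂ) else 0) i j =
      if Function.Injective i ∧ Function.Injective j then
        (if T ⊆ Finset.univ.image i ∩ Finset.univ.image j then (1 : ℂ) else 0) else 0 := by
    intro T
    by_cases hi : Function.Injective i <;> by_cases hj : Function.Injective j <;>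
      by_cases h1 : T ⊆ Finset.univ.image i <;> by_cases h2 : T ⊆ Finset.univ.image j <;>
      simp [Matrix.vecMulVec_apply, hi, hj, h1, h2, Finset.subset_inter_iff]
  rw [inclusionGram, Matrix.sum_apply, Finset.sum_congr rfl fun T _ => hterm T]
  split_ifs
  · rw [Finset.sum_boole, ← Finset.card_powersetCard]
    congr 2
    ext T
    simp [Finset.mem_powersetCard, and_comm]
  · simp

/-- Two `k`-element sets meet in `k` points only if they coincide, so `choose k` of the intersection
size is the indicator of equality. -/
theorem inclusionGram_self (d k : ℕ) : inclusionGram d k k = distinctSym d k := by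
  classical
  ext i j
  rw [inclusionGram_apply, distinctSym, Matrix.of_apply]
  by_cases hij : Function.Injective i ∧ Function.Injective j
  · rw [if_pos hij]
    have hi := card_image_of_injective_tuple hij.1
    have hj := card_image_of_injective_tuple hij.2
    by_cases hr : Set.range i = Set.range j
    · rw [if_pos ⟨hij.1, hij.2, hr⟩, (image_univ_eq_iff i j).mpr hr, Finset.inter_self, hj]
      simp
    · rw [if_neg fun h => hr h.2.2, Nat.choose_eq_zero_of_lt]
      · simp
      · rw [← image_univ_eq_iff] at hr
        refine lt_of_le_of_ne ((Finset.card_le_card Finset.inter_subset_left).trans_eq hi) fun h => hr ?_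
        have h1 := Finset.eq_of_subset_of_card_le
          (Finset.inter_subset_left (s₁ := Finset.univ.image i) (s₂ := Finset.univ.image j))
          (by omega)
        have h2 := Finset.eq_of_subset_of_card_le
          (Finset.inter_subset_right (s₁ := Finset.univ.image i) (s₂ := Finset.univ.image j))
          (by omega)
        rw [← h1, h2]
  · rw [if_neg hij, if_neg fun h => hij ⟨h.1, h.2.1⟩]

theorem subsetMomentDistinct_eq_sum {s k : ℕ} (hs : 1 ≤ s) (hsd : s ≤ d) (hkd : 2 * k ≤ d) :
    subsetMomentDistinct d s k = (((d.choose s : ℝ)⁻¹ * ((s : ℝ) ^ k)⁻¹ : ℝ) : ℂ) •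
      ∑ p ∈ Finset.HasAntidiagonal.antidiagonal (d - s),
        (((d - 2 * k).choose p.2 : ℝ) : ℂ) • inclusionGram d k p.1 := by
  classical
  ext i j
  rw [subsetMomentDistinct_apply hs hsd, Matrix.smul_apply, Matrix.sum_apply, smul_eq_mul]
  congr 1
  simp only [Matrix.smul_apply, inclusionGram_apply, smul_eq_mul]
  split_ifs with hij
  · have hi := card_image_of_injective_tuple hij.1
    have hj := card_image_of_injective_tuple hij.2
    have hu := Finset.card_union_add_card_inter (Finset.univ.image i) (Finset.univ.image j)
    -- The union has `2k` minus the intersection size many elements; `2 * k ≤ d` lets the upper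
    -- index split into two natural numbers for Vandermonde.
    have : d - (Finset.univ.image i ∪ Finset.univ.image j).card =
        (Finset.univ.image i ∩ Finset.univ.image j).card + (d - 2 * k) := by
      have := Finset.card_le_card
        (Finset.subset_univ (Finset.univ.image i ∪ Finset.univ.image j))
      rw [Finset.card_univ, Fintype.card_fin] at this
      omega
    rw [this, Nat.add_choose_eq, Nat.cast_sum]
    refine Finset.sum_congr rfl fun p _ => ?_
    push_cast
    ring
  · simp

/-- The weight of `distinctSym d k` in the decomposition of `subsetMomentDistinct d s k`. -/
noncomputable def subsetWeight (d s k : ℕ) : ℝ :=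
  (d.choose s : ℝ)⁻¹ * ((s : ℝ) ^ k)⁻¹ * (d - 2 * k).choose (d - s - k)

/-- Subtracting removes exactly the `r = k` Vandermonde term; the others are Gram matrices with
nonnegative coefficients. -/
theorem subsetMomentDistinct_sub_posSemidef {s k : ℕ} (hs : 1 ≤ s) (hkd : 2 * k ≤ d)
    (hskd : s + k ≤ d) :
    (subsetMomentDistinct d s k - (subsetWeight d s k : ℂ) • distinctSym d k).PosSemidef := by
  have hmem : (k, d - s - k) ∈ Finset.HasAntidiagonal.antidiagonal (d - s) := by
    rw [Finset.HasAntidiagonal.mem_antidiagonal]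
    omega
  have : subsetMomentDistinct d s k - (subsetWeight d s k : ℂ) • distinctSym d k =
      (((d.choose s : ℝ)⁻¹ * ((s : ℝ) ^ k)⁻¹ : ℝ) : ℂ) •
      ∑ p ∈ (Finset.HasAntidiagonal.antidiagonal (d - s)).erase (k, d - s - k),
        (((d - 2 * k).choose p.2 : ℝ) : ℂ) • inclusionGram d k p.1 := by
    rw [subsetMomentDistinct_eq_sum hs (by omega) hkd, ← Finset.add_sum_erase _ _ hmem, smul_add,
      inclusionGram_self, smul_smul, ← Complex.ofReal_mul, subsetWeight, add_sub_cancel_left]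
  rw [this]
  refine Matrix.PosSemidef.smul (Matrix.posSemidef_sum _ fun p _ => ?_)
    (Complex.zero_le_real.mpr (by positivity))
  exact (inclusionGram_posSemidef d k p.1).smul (Complex.zero_le_real.mpr (by positivity))

/-! ### Estimating the weight of the common part -/

theorem choose_sub_mul_descFactorial {n m k : ℕ} (hkm : k ≤ m) :
    (n - k).choose (m - k) * n.descFactorial k = n.choose m * m.descFactorial k := by
  rw [Nat.descFactorial_eq_factorial_mul_choose, Nat.descFactorial_eq_factorial_mul_choose]
  have := Nat.choose_mul (n := n) hkm
  zify at this ⊢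
  linear_combination (-(k.factorial : ℤ)) * this

theorem one_sub_mul_le_pow_one_sub {x : ℝ} (hx : x ≤ 2) (k : ℕ) : 1 - k * x ≤ (1 - x) ^ k := by
  have := one_add_mul_le_pow (a := -x) (by linarith) k
  rw [← sub_eq_add_neg] at this
  linarith

theorem one_sub_le_descFactorial_div_pow {s k : ℕ} (hs : 1 ≤ s) (hk : k ≤ s) :
    1 - (k : ℝ) ^ 2 / s ≤ s.descFactorial k / (s : ℝ) ^ k := by
  have hs0 : (0 : ℝ) < s := by exact_mod_cast hs
  have hks : (k : ℝ) ≤ s := by exact_mod_cast hk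
  calc 1 - (k : ℝ) ^ 2 / s = 1 - k * (k / s) := by ring
    _ ≤ (1 - (k : ℝ) / s) ^ k :=
        one_sub_mul_le_pow_one_sub (((div_le_one hs0).mpr hks).trans one_le_two) k
    _ = ((s - k : ℕ) : ℝ) ^ k / (s : ℝ) ^ k := by
        rw [← div_pow, Nat.cast_sub hk, sub_div, div_self hs0.ne']
    _ ≤ _ := by
        refine div_le_div_of_nonneg_right ?_ (by positivity)
        exact_mod_cast (Nat.pow_le_pow_left (by omega) k).trans (Nat.pow_sub_le_descFactorial s k)

theorem one_sub_le_descFactorial_div_descFactorial {s k : ℕ} (hd : 1 ≤ d) (hkd : 2 * k ≤ d)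
    (hskd : s + k ≤ d) :
    1 - 2 * ((s : ℝ) * k / d) ≤ (d - s).descFactorial k / (d - k).descFactorial k := by
  have hd0 : (0 : ℝ) < d := by exact_mod_cast hd
  have hkd' : 2 * (k : ℝ) ≤ d := by exact_mod_cast hkd
  have hskd' : (s : ℝ) + k ≤ d := by exact_mod_cast hskd
  have hs0 : (0 : ℝ) ≤ s := by positivity
  have hk0 : (0 : ℝ) ≤ k := by positivity
  have hdk : (0 : ℝ) < d - k := by linarith
  have hpos : (0 : ℝ) < (d - k).descFactorial k := by
    exact_mod_cast Nat.descFactorial_pos.mpr (by omega)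
  calc 1 - 2 * ((s : ℝ) * k / d) = 1 - k * (2 * s / d) := by ring
    _ ≤ 1 - k * (s / (d - k)) := by
        -- Since `2 * k ≤ d`, the denominator `d - k` is at least `d / 2`; this is the source of the
        -- factor `2`.
        have : (s : ℝ) / (d - k) ≤ 2 * s / d := by
          rw [div_le_div_iff₀ hdk hd0]
          nlinarith
        nlinarith
    _ ≤ (1 - (s : ℝ) / (d - k)) ^ k := by
        refine one_sub_mul_le_pow_one_sub ?_ k
        rw [div_le_iff₀ hdk]
        linarith
    _ = ((d - s - k : ℕ) : ℝ) ^ k / ((d - k : ℕ) : ℝ) ^ k := by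
        rw [← div_pow, Nat.cast_sub (by omega), Nat.cast_sub (by omega), Nat.cast_sub (by omega)]
        congr 1
        field_simp
        ring
    _ ≤ (d - s).descFactorial k / ((d - k : ℕ) : ℝ) ^ k := by
        refine div_le_div_of_nonneg_right ?_ (by positivity)
        exact_mod_cast (Nat.pow_le_pow_left (by omega) k).trans
          (Nat.pow_sub_le_descFactorial (d - s) k)
    _ ≤ _ := by
        refine div_le_div_of_nonneg_left (by positivity) hpos ?_
        exact_mod_cast Nat.descFactorial_le_pow (d - k) k

/-- Absorption is applied twice, to `(d - k).choose (d - s)` and to `d.choose s`; both produce the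
intermediate `(d - k).choose (d - s)`, which cancels. -/
theorem subsetWeight_mul_descFactorial {s k : ℕ} (hks : k ≤ s) (hskd : s + k ≤ d)
    (hkd : 2 * k ≤ d) :
    subsetWeight d s k * d.descFactorial k =
      (s.descFactorial k / (s : ℝ) ^ k) * ((d - s).descFactorial k / (d - k).descFactorial k) := by
  have h1 := choose_sub_mul_descFactorial (n := d - k) (m := d - s) (k := k) (by omega)
  have h2 := choose_sub_mul_descFactorial (n := d) (m := s) (k := k) hks
  have h3 : (d - k).choose (s - k) = (d - k).choose (d - s) := by
    rw [← Nat.choose_symm (by omega : d - s ≤ d - k)]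
    congr 1
    omega
  rw [show d - k - k = d - 2 * k by omega] at h1
  rw [h3] at h2
  have hpos : ((d - k).descFactorial k : ℝ) ≠ 0 := by
    exact_mod_cast (Nat.descFactorial_pos.mpr (by omega)).ne'
  have hch : (d.choose s : ℝ) ≠ 0 := by exact_mod_cast (Nat.choose_pos (by omega)).ne'
  have h1' : ((d - 2 * k).choose (d - s - k) : ℝ) =
      (d - k).choose (d - s) * (d - s).descFactorial k / (d - k).descFactorial k := by
    rw [eq_div_iff hpos]
    exact_mod_cast h1
  have h2' : (s.descFactorial k : ℝ) =
      (d - k).choose (d - s) * d.descFactorial k / d.choose s := by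
    rw [eq_div_iff hch]
    have : ((d - k).choose (d - s) : ℝ) * d.descFactorial k = d.choose s * s.descFactorial k := by
      exact_mod_cast h2
    rw [this, mul_comm]
  rw [subsetWeight, h1', h2']
  ring

theorem one_sub_le_subsetWeight_mul {s k : ℕ} (hs : 1 ≤ s) (hks : k ≤ s) (hskd : s + k ≤ d)
    (hkd : 2 * k ≤ d) :
    1 - ((k : ℝ) ^ 2 / s + 2 * ((s : ℝ) * k / d)) ≤ subsetWeight d s k * d.descFactorial k := by
  rw [subsetWeight_mul_descFactorial hks hskd hkd]
  have hx := one_sub_le_descFactorial_div_pow hs hks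
  have hy := one_sub_le_descFactorial_div_descFactorial (d := d) (by omega) hkd hskd
  have hs0 : (0 : ℝ) < s := by exact_mod_cast hs
  have hx1 : s.descFactorial k / (s : ℝ) ^ k ≤ 1 := by
    rw [div_le_one (by positivity)]
    exact_mod_cast Nat.descFactorial_le_pow s k
  have hx0 : 0 ≤ s.descFactorial k / (s : ℝ) ^ k := by positivity
  have hb : (0 : ℝ) ≤ s * k / d := by positivity
  nlinarith [mul_le_mul_of_nonneg_left hy hx0]

end SubsetMoment

/-! ### Comparing the two moments -/

theorem traceNorm_haarMoment_sub_le_two {d s : ℕ} (k : ℕ) (hs : 1 ≤ s) (hsd : s ≤ d) :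
    traceNorm (haarMoment d k - subsetMoment d s k) ≤ 2 := by
  have h := (PosSplit.of_posSemidef (haarMoment_posSemidef (hs.trans hsd) k)).sub
    (posSplit_subsetMoment hs hsd k)
  rw [re_trace_haarMoment (hs.trans hsd)] at h
  exact h.traceNorm_le.trans (by norm_num)

theorem haarMoment_zero_eq_subsetMoment {d s : ℕ} (hs : 1 ≤ s) (hsd : s ≤ d) :
    haarMoment d 0 = subsetMoment d s 0 := by
  have := haarState_isProbabilityMeasure d (hs.trans hsd)
  have hch : (d.choose s : ℂ) ≠ 0 := by exact_mod_cast (Nat.choose_pos hsd).ne'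
  ext i j
  simp [haarMoment_apply, subsetMoment, tensorPower, hch]

theorem traceNorm_haarMoment_sub_le {d s k : ℕ} (hs : 1 ≤ s) (hk : 1 ≤ k) (hks : k ≤ s)
    (hskd : s + k ≤ d) (hkd : 2 * k ≤ d) :
    traceNorm (haarMoment d k - subsetMoment d s k) ≤
      4 * ((k : ℝ) ^ 2 / d) + 4 * ((s : ℝ) * k / d) + 3 * ((k : ℝ) ^ 2 / s) + 2 * (k / √s) := by
  have hsd : s ≤ d := by omega
  obtain ⟨h, ha, ha1, hH⟩ := exists_posSplit_haarMoment_sub (hs.trans hsd) k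
  have hb := one_sub_le_subsetWeight_mul hs hks hskd hkd
  have htr := re_trace_subsetMomentDistinct_le hs hsd k
  set c := subsetWeight d s k with hc
  have hpsd := subsetMomentDistinct_sub_posSemidef hs hkd hskd
  have hR := PosSplit.of_posSemidef hpsd
  have hR0 : 0 ≤ (subsetMomentDistinct d s k - (c : ℂ) • distinctSym d k).trace.re :=
    (Complex.nonneg_iff.mp hpsd.trace_nonneg).1
  have hRtr : (subsetMomentDistinct d s k - (c : ℂ) • distinctSym d k).trace.re =
      (subsetMomentDistinct d s k).trace.re - c * d.descFactorial k := by
    rw [Matrix.trace_sub, Matrix.trace_smul, smul_eq_mul, Complex.sub_re, Complex.re_ofReal_mul,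
      re_trace_distinctSym]
  rw [hRtr] at hR hR0
  have hB := (PosSplit.of_posSemidef (distinctSym_posSemidef d k)).smul (h - c)
  rw [re_trace_distinctSym] at hB
  have hE := posSplit_subsetMoment_sub hs hsd hk
  have key := ((hH.add hB).sub hR).sub hE
  have hM : haarMoment d k - (h : ℂ) • distinctSym d k + ((h - c : ℝ) : ℂ) • distinctSym d k -
      (subsetMomentDistinct d s k - (c : ℂ) • distinctSym d k) -
      (subsetMoment d s k - subsetMomentDistinct d s k) =
      haarMoment d k - subsetMoment d s k := by
    rw [Complex.ofReal_sub, sub_smul]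
    abel
  rw [hM] at key
  refine key.traceNorm_le.trans ?_
  -- Both `h` and `c` times `d.descFactorial k` lie below `1`, each within its own error, so their
  -- distance is at most the sum of the errors.
  have habs : |h - c| * d.descFactorial k ≤
      2 * ((k : ℝ) ^ 2 / d) + ((k : ℝ) ^ 2 / s + 2 * ((s : ℝ) * k / d)) := by
    rw [← Nat.abs_cast (d.descFactorial k), ← abs_mul, sub_mul, abs_le]
    have e1 : (0 : ℝ) ≤ (k : ℝ) ^ 2 / d := by positivity
    have e2 : (0 : ℝ) ≤ (k : ℝ) ^ 2 / s := by positivity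
    have e3 : (0 : ℝ) ≤ (s : ℝ) * k / d := by positivity
    constructor <;> linarith
  linarith

theorem theorem1 :
    ∃ C : ℝ, 0 < C ∧ ∀ d s k : ℕ, 1 ≤ s → s ≤ d →
      traceNorm (haarMoment d k - subsetMoment d s k) ≤
        C * ((k : ℝ) ^ 2 / d + (k : ℝ) / Real.sqrt s + (s : ℝ) * k / d) := by
  -- In the main regime `3 k²/s ≤ 3 k/√s` joins `2 k/√s` to give `5`; otherwise `5 · (1/2)` exceeds
  -- the trivial bound `2`.
  refine ⟨5, by norm_num, fun d s k hs hsd => ?_⟩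
  have hs0 : (0 : ℝ) < s := by exact_mod_cast hs
  have hd0 : (0 : ℝ) < d := by exact_mod_cast hs.trans hsd
  have hsq := Real.sq_sqrt hs0.le
  have hsp := Real.sqrt_pos.mpr hs0
  have e1 : (0 : ℝ) ≤ (k : ℝ) ^ 2 / d := by positivity
  have e2 : (0 : ℝ) ≤ (k : ℝ) / √s := by positivity
  have e3 : (0 : ℝ) ≤ (s : ℝ) * k / d := by positivity
  rcases Nat.eq_zero_or_pos k with rfl | hk
  · rw [haarMoment_zero_eq_subsetMoment hs hsd, sub_self]
    exact PosSplit.zero.traceNorm_le.trans (by positivity)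
  have hk1 : (1 : ℝ) ≤ k := by exact_mod_cast hk
  by_cases hbig : 1 / 2 ≤ (k : ℝ) / √s ∨ 1 / 2 ≤ (s : ℝ) * k / d
  · refine (traceNorm_haarMoment_sub_le_two k hs hsd).trans ?_
    rcases hbig with h | h <;> linarith
  · push Not at hbig
    obtain ⟨h1, h2⟩ := hbig
    have hks : (k : ℝ) ^ 2 / s ≤ k / √s := by
      have : (k : ℝ) ^ 2 / s = (k / √s) ^ 2 := by rw [div_pow, hsq]
      rw [this]
      nlinarith
    rw [div_lt_iff₀ hsp] at h1
    rw [div_lt_iff₀ hd0] at h2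
    -- From `2k < √s` and `k ≥ 1` one gets `√s ≥ 2`, hence `4k ≤ 2√s ≤ s`.
    have h3 : 4 * (k : ℝ) ≤ s := by nlinarith
    have h4 : 2 * (s : ℝ) ≤ d := by nlinarith
    have h3' : 4 * k ≤ s := by exact_mod_cast h3
    have h4' : 2 * s ≤ d := by exact_mod_cast h4
    have := traceNorm_haarMoment_sub_le hs hk (by omega) (by omega) (by omega : 2 * k ≤ d)
    linarith
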